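/- A binary sequence is a finite sequence of $0$s and $1$s; $2^{<m}$ is the set of those of length less than $m$, $\eta\subseteq\eta'$ means that $\eta$ is an initial segment of $\eta'$, and $\eta\wedge j$ is $\eta$ with the digit $j$ appended. Let $G=(V,E)$ be a finite simple graph with $|V|=n$. A \emph{type tree} for $G$ is a labeling $V=\{a_\eta \mid \eta\in A\}$, each vertex being used exactly once, by a set $A\subseteq 2^{<n}$ closed under initial segments, such that (1) for $\eta\in A$: if $\eta\wedge 0\in A$, then $a_{\eta\wedge 0}$ is not adjacent to $a_\eta$; if $\eta\wedge 1\in A$, then $a_{\eta\wedge 1}$ is adjacent to $a_\eta$; (2) if $\eta\subsetneq\eta'\subsetneq\eta''$ are in $A$, then $a_\eta$ is adjacent to $a_{\eta'}$ if and only if $a_\eta$ is adjacent to $a_{\eta''}$. It has \emph{height} $h$ if $A\subseteq 2^{<h}$ but $A\not\subseteq 2^{<h-1}$. The \emph{tree rank} of $G$ is the largest integer $t$ such that for some $V'\subseteq V$ the induced graph on $V'$ has a type tree with index set $2^{<t}$. **Theorem.** Let $G=(V,E)$ be a finite simple graph with $|V|=n$ and tree rank $t\ge 2$. Suppose that $A\subseteq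 2^{<n}$ and $V=\{a_\eta\mid\eta\in A\}$ is a type tree of height $h$, where $h\ge 2t$. Then, unless $(t,h,n)=(2,4,10)$, $$h\ \ge\ \bigl(n\cdot (t-2)!\bigr)^{1/t}+1 .$$ Moreover, in all cases (including $(t,h,n)=(2,4,10)$), $G$ has a clique or an independent set of size at least $$\frac{\bigl(n\cdot (t-2)!\bigr)^{1/t}+1}{2}.$$ -/

import Mathlib

namespace TypeTree

/-- The set `2^{<n}` of binary sequences of length less than `n`
(`false` is the digit `0` and `true` is the digit `1`). -/
def binSeqLT (n : ℕ) : Set (List Bool) := {η | η.length < n}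

/-- `V = {a_η | η ∈ A}` is a type tree for the graph `G` on `V`: `A` is a set of binary sequences
of length less than `|V|` closed under initial segments, `a` labels the vertices of `G` by the
elements of `A` (each vertex exactly once), and the adjacency conditions below hold. -/
structure IsTypeTree {V : Type*} (G : SimpleGraph V) (A : Set (List Bool)) (a : A → V) : Prop where
  subset_binSeqLT : A ⊆ binSeqLT (Nat.card V)
  prefix_mem : ∀ η ∈ A, ∀ ζ : List Bool, ζ <+: η → ζ ∈ A
  bijective : Function.Bijective a
  /-- If `η ∧ 0 ∈ A`, then `a_{η ∧ 0}` is nonadjacent to `a_η`. -/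
  not_adj_of_append_false : ∀ η ζ : A, (ζ : List Bool) = (η : List Bool) ++ [false] →
    ¬ G.Adj (a ζ) (a η)
  /-- If `η ∧ 1 ∈ A`, then `a_{η ∧ 1}` is adjacent to `a_η`. -/
  adj_of_append_true : ∀ η ζ : A, (ζ : List Bool) = (η : List Bool) ++ [true] →
    G.Adj (a ζ) (a η)
  /-- If `η ⊊ ζ ⊊ ξ` in `A`, then `a_η` is adjacent to `a_ζ` iff it is adjacent to `a_ξ`. -/
  adj_iff_adj : ∀ η ζ ξ : A,
    (η : List Bool) <+: (ζ : List Bool) → η ≠ ζ →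
    (ζ : List Bool) <+: (ξ : List Bool) → ζ ≠ ξ →
    (G.Adj (a η) (a ζ) ↔ G.Adj (a η) (a ξ))

/-- The index set `A` of a type tree has height `h` (for `h ≥ 1`):
`A ⊆ 2^{<h}` but `A ⊈ 2^{<h-1}`. -/
def HasHeight (A : Set (List Bool)) (h : ℕ) : Prop :=
  A ⊆ binSeqLT h ∧ ¬ A ⊆ binSeqLT (h - 1)

/-- The graph `G` has tree rank `t`: `t` is the largest integer such that some induced subgraph
of `G` has a type tree whose index set is all of `2^{<t}`. -/
def HasTreeRank {V : Type*} (G : SimpleGraph V) (t : ℕ) : Prop :=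
  IsGreatest {s : ℕ | ∃ (W : Set V) (a : binSeqLT s → W),
    IsTypeTree (G.induce W) (binSeqLT s) a} t

end TypeTree

/-!
In a type tree the digit after `η` decides whether `a_η` is adjacent to any vertex further up, so a
copy of `2^{<s}` inside `A` that respects branching spans an induced subgraph with type tree
`2^{<s}`. If `G` has tree rank at most `t`, then `A` contains no such copy of `2^{<t+1}`, and above
every node one of the two successors carries no copy of the next smaller full tree. With Pascal's
rule this gives `n ≤ ∑_{i=1}^t (h choose i)`, which is at most `(h - 1)^t / (t - 2)!` outside a few
cases with `t = 2`, and at most `h^t / (t - 2)!` whenever `h ≥ t`. Along a longest branch, the nodes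
followed by a fixed digit, together with the top node, form a clique or an independent set, and one
of the two digits accounts for at least `(h + 1) / 2` vertices.
-/

namespace TypeTree

section Adjacency

variable {V : Type*} {G : SimpleGraph V} {A : Set (List Bool)} {a : A → V}

theorem IsTypeTree.adj_iff (hT : IsTypeTree G A a) {η ξ : A} {j : Bool}
    (hξ : (η : List Bool) ++ [j] <+: (ξ : List Bool)) : G.Adj (a η) (a ξ) ↔ j = true := by
  let ζ : A := ⟨_, hT.prefix_mem _ ξ.2 _ hξ⟩
  have adj_succ : G.Adj (a η) (a ζ) ↔ j = true := by
    rw [G.adj_comm]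
    cases j with
    | false => simpa using hT.not_adj_of_append_false η ζ rfl
    | true => simpa using hT.adj_of_append_true η ζ rfl
  by_cases hζξ : ζ = ξ
  · rwa [← hζξ]
  · have hηζ : η ≠ ζ := fun e => by simpa [ζ] using congrArg (fun x : A => x.1.length) e
    rwa [← hT.adj_iff_adj η ζ ξ (List.prefix_append _ _) hηζ hξ hζξ]

theorem length_lt_card_of_prefix_mem [Finite A]
    (hA : ∀ η ∈ A, ∀ ζ : List Bool, ζ <+: η → ζ ∈ A) {η : List Bool} (hη : η ∈ A) :
    η.length < Nat.card A := by
  let initial (i : Fin (η.length + 1)) : A := ⟨η.take i, hA η hη _ (List.take_prefix _ _)⟩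
  have initial_injective : Function.Injective initial := fun i k e => by
    have hlen := congrArg (fun ζ : A => ζ.1.length) e
    simp only [initial, List.length_take] at hlen
    omega
  simpa using Nat.card_le_card_of_injective initial initial_injective

theorem IsTypeTree.of_adj_iff [Finite V] (hA : ∀ η ∈ A, ∀ ζ : List Bool, ζ <+: η → ζ ∈ A)
    (ha : Function.Bijective a)
    (hadj : ∀ (η ξ : A) (j : Bool), (η : List Bool) ++ [j] <+: (ξ : List Bool) →
      (G.Adj (a η) (a ξ) ↔ j = true)) : IsTypeTree G A a where
  subset_binSeqLT η hη := by
    have : Finite A := Finite.of_injective a ha.injective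
    rw [← Nat.card_congr (Equiv.ofBijective a ha)]
    exact length_lt_card_of_prefix_mem hA hη
  prefix_mem := hA
  bijective := ha
  not_adj_of_append_false η ζ hζ := by
    simp [G.adj_comm, hadj η ζ false (by rw [hζ])]
  adj_of_append_true η ζ hζ := by
    simp [G.adj_comm, hadj η ζ true (by rw [hζ])]
  adj_iff_adj := by
    rintro η ⟨_, hζ⟩ ξ ⟨_ | ⟨j, ρ⟩, rfl⟩ hne hξ -
    · simp at hne
    · have hj : (η : List Bool) ++ [j] <+: η ++ j :: ρ := ⟨ρ, by simp⟩
      rw [hadj η ⟨_, hζ⟩ j hj, hadj η ξ j (hj.trans hξ)]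

end Adjacency

section FullTree

variable {A : Set (List Bool)} {s : ℕ} {η : List Bool}

/-- The part of `A` above `η` contains a copy of the full binary tree `2^{<s}` in which the two
subtrees at every node lie above its two immediate successors. -/
def ContainsFullTree (A : Set (List Bool)) : ℕ → List Bool → Prop
  | 0, _ => True
  | s + 1, η => ∃ ζ ∈ A, η <+: ζ ∧ ∀ j, ContainsFullTree A s (ζ ++ [j])

theorem ContainsFullTree.of_prefix {ζ : List Bool} (hp : η <+: ζ) (h : ContainsFullTree A s ζ) :
    ContainsFullTree A s η := by
  cases s with
  | zero => trivial
  | succ s =>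
    obtain ⟨ξ, hξ, hζξ, hsub⟩ := h
    exact ⟨ξ, hξ, hp.trans hζξ, hsub⟩

/-- `f` embeds the full binary tree `2^{<s}` into the binary sequences so that the two subtrees at
every node go above the two corresponding immediate successors of its image. -/
def IsTreeEmbedding (s : ℕ) (f : List Bool → List Bool) : Prop :=
  ∀ ξ ζ j, ζ ∈ binSeqLT s → ξ ++ [j] <+: ζ → f ξ ++ [j] <+: f ζ

theorem cons_mem_binSeqLT_succ {b : Bool} {ξ : List Bool} :
    b :: ξ ∈ binSeqLT (s + 1) ↔ ξ ∈ binSeqLT s := by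
  simp [binSeqLT]

theorem IsTreeEmbedding.injOn {f : List Bool → List Bool} (hf : IsTreeEmbedding s f) :
    Set.InjOn f (binSeqLT s) := by
  induction s generalizing f with
  | zero => simp [binSeqLT]
  | succ s ih =>
    have root_lt : ∀ b ξ, b :: ξ ∈ binSeqLT (s + 1) → f [] ++ [b] <+: f (b :: ξ) :=
      fun b ξ h => hf [] (b :: ξ) b h (by simp)
    rintro (_ | ⟨b, ξ⟩) hξ (_ | ⟨c, ζ⟩) hζ e
    · rfl
    · simpa [← e] using (root_lt c ζ hζ).length_le
    · simpa [e] using (root_lt b ξ hξ).length_le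
    · have hb := root_lt b ξ hξ
      rw [e] at hb
      obtain rfl : b = c := by
        simpa using (List.prefix_of_prefix_length_le hb (root_lt c ζ hζ) (by simp)).eq_of_length
      have hsub : IsTreeEmbedding s fun ρ => f (b :: ρ) := fun ξ ζ j hζ hp =>
        hf (b :: ξ) (b :: ζ) j (cons_mem_binSeqLT_succ.2 hζ) (by simpa using hp)
      rw [ih hsub (cons_mem_binSeqLT_succ.1 hξ) (cons_mem_binSeqLT_succ.1 hζ) e]

theorem ContainsFullTree.exists_isTreeEmbedding (h : ContainsFullTree A s η) :
    ∃ f, IsTreeEmbedding s f ∧ ∀ ξ ∈ binSeqLT s, f ξ ∈ A ∧ η <+: f ξ := by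
  induction s generalizing η with
  | zero => exact ⟨id, by simp [IsTreeEmbedding, binSeqLT], by simp [binSeqLT]⟩
  | succ s ih =>
    obtain ⟨ζ, hζ, hηζ, hsub⟩ := h
    choose g hg hgA using fun j => ih (hsub j)
    refine ⟨fun | [] => ζ | b :: ξ => g b ξ, ?_, ?_⟩
    · rintro (_ | ⟨c, ξ⟩) (_ | ⟨b, ρ⟩) j hρ hp
      · simp at hp
      · obtain rfl : j = b := by simpa using hp
        exact (hgA j ρ (cons_mem_binSeqLT_succ.1 hρ)).2
      · simp at hp
      · obtain ⟨rfl, hξρ⟩ := List.cons_prefix_cons.1 (List.cons_append ▸ hp)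
        exact hg c ξ ρ j (cons_mem_binSeqLT_succ.1 hρ) hξρ
    · rintro (_ | ⟨b, ξ⟩) hξ
      · exact ⟨hζ, hηζ⟩
      · obtain ⟨hmem, hp⟩ := hgA b ξ (cons_mem_binSeqLT_succ.1 hξ)
        exact ⟨hmem, (hηζ.trans (List.prefix_append _ _)).trans hp⟩

/-- Some induced subgraph of `G` has a type tree with index set `2^{<s}`; the tree rank of `G` is
the largest such `s`. -/
def HasFullTypeTree {V : Type*} (G : SimpleGraph V) (s : ℕ) : Prop :=
  ∃ (W : Set V) (a : binSeqLT s → W), IsTypeTree (G.induce W) (binSeqLT s) a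

theorem finite_binSeqLT (s : ℕ) : (binSeqLT s).Finite :=
  List.finite_length_lt Bool s

theorem IsTypeTree.hasFullTypeTree {V : Type*} {G : SimpleGraph V} {a : A → V}
    (hT : IsTypeTree G A a) (hs : ContainsFullTree A s η) : HasFullTypeTree G s := by
  obtain ⟨f, hf, hfA⟩ := hs.exists_isTreeEmbedding
  let F : binSeqLT s → A := fun ξ => ⟨f ξ, (hfA ξ ξ.2).1⟩
  have hF : Function.Injective F := fun ξ ζ e =>
    Subtype.ext (hf.injOn ξ.2 ζ.2 (congrArg Subtype.val e))
  have : Finite (binSeqLT s) := finite_binSeqLT s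
  refine ⟨Set.range (a ∘ F), Equiv.ofInjective _ (hT.bijective.1.comp hF), .of_adj_iff ?_
    (Equiv.bijective _) fun ξ ζ j hp => hT.adj_iff (hf ξ ζ j ζ.2 hp)⟩
  exact fun ξ hξ ζ hp => hp.length_le.trans_lt hξ

end FullTree

section Counting

variable {A : Set (List Bool)}

/-- The elements of `A` that extend `η`. -/
def cone (A : Set (List Bool)) (η : List Bool) : Set (List Bool) := {ξ ∈ A | η <+: ξ}

theorem cone_subset_insert (A : Set (List Bool)) (η : List Bool) (j : Bool) :
    cone A η ⊆ insert η (cone A (η ++ [j]) ∪ cone A (η ++ [!j])) := by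
  rintro ξ ⟨hξ, _ | ⟨b, ρ⟩, rfl⟩
  · simp
  · have hb : η ++ [b] <+: η ++ b :: ρ := ⟨ρ, by simp⟩
    rcases Bool.eq_or_eq_not b j with rfl | rfl
    · exact .inr (.inl ⟨hξ, hb⟩)
    · exact .inr (.inr ⟨hξ, hb⟩)

theorem ncard_cone_le (hA : A.Finite) (η : List Bool) (j : Bool) :
    (cone A η).ncard ≤ 1 + (cone A (η ++ [j])).ncard + (cone A (η ++ [!j])).ncard := by
  have hfin : ∀ ζ, (cone A ζ).Finite := fun ζ => hA.subset (Set.sep_subset _ _)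
  calc (cone A η).ncard
      ≤ (insert η (cone A (η ++ [j]) ∪ cone A (η ++ [!j]))).ncard :=
        Set.ncard_le_ncard (cone_subset_insert A η j) (((hfin _).union (hfin _)).insert η)
    _ ≤ (cone A (η ++ [j]) ∪ cone A (η ++ [!j])).ncard + 1 := Set.ncard_insert_le _ _
    _ ≤ (cone A (η ++ [j])).ncard + (cone A (η ++ [!j])).ncard + 1 := by
        gcongr; exact Set.ncard_union_le _ _
    _ = _ := by ring

theorem sum_range_choose_succ (m t : ℕ) :
    ∑ i ∈ Finset.range (t + 1), (m + 1).choose (i + 1) =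
      1 + ∑ i ∈ Finset.range t, m.choose (i + 1) +
        ∑ i ∈ Finset.range (t + 1), m.choose (i + 1) := by
  simp only [Nat.choose_succ_succ, Finset.sum_add_distrib]
  rw [Finset.sum_range_succ' fun i => m.choose i, Nat.choose_zero_right, add_comm 1]

theorem ncard_cone_le_sum_choose (hA : ∀ η ∈ A, ∀ ζ : List Bool, ζ <+: η → ζ ∈ A) {m t : ℕ}
    {η : List Bool} (hm : A ⊆ binSeqLT (η.length + m)) (hη : ¬ ContainsFullTree A (t + 1) η) :
    (cone A η).ncard ≤ ∑ i ∈ Finset.range t, m.choose (i + 1) := by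
  induction m generalizing t η with
  | zero =>
    have : cone A η = ∅ := Set.eq_empty_of_forall_notMem fun ξ hξ =>
      (hm hξ.1).not_ge hξ.2.length_le
    simp [this]
  | succ m ih =>
    by_cases hηA : η ∈ A
    swap
    · have : cone A η = ∅ := Set.eq_empty_of_forall_notMem fun ξ hξ => hηA (hA ξ hξ.1 η hξ.2)
      simp [this]
    cases t with
    | zero => exact absurd ⟨η, hηA, List.prefix_refl η, fun _ => trivial⟩ hη
    | succ t =>
      have hm' : ∀ j, A ⊆ binSeqLT ((η ++ [j]).length + m) := fun j => by
        rwa [List.length_append, List.length_singleton, add_assoc, add_comm 1]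
      obtain ⟨j, hj⟩ : ∃ j, ¬ ContainsFullTree A (t + 1) (η ++ [j]) := by
        by_contra! hall
        exact hη ⟨η, hηA, List.prefix_refl η, hall⟩
      have hother : ¬ ContainsFullTree A (t + 1 + 1) (η ++ [!j]) := fun h =>
        hη (h.of_prefix (List.prefix_append _ _))
      calc (cone A η).ncard
          ≤ 1 + (cone A (η ++ [j])).ncard + (cone A (η ++ [!j])).ncard :=
            ncard_cone_le ((finite_binSeqLT _).subset hm) η j
        _ ≤ 1 + ∑ i ∈ Finset.range t, m.choose (i + 1) +
              ∑ i ∈ Finset.range (t + 1), m.choose (i + 1) := by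
            gcongr
            exacts [ih (hm' j) hj, ih (hm' !j) hother]
        _ = ∑ i ∈ Finset.range (t + 1), (m + 1).choose (i + 1) :=
            (sum_range_choose_succ m t).symm

theorem IsTypeTree.card_le_sum_choose {V : Type*} {G : SimpleGraph V} {a : A → V}
    (hT : IsTypeTree G A a) {m t : ℕ} (hm : A ⊆ binSeqLT m)
    (hrank : ¬ HasFullTypeTree G (t + 1)) :
    Nat.card V ≤ ∑ i ∈ Finset.range t, m.choose (i + 1) := by
  have hcone : cone A [] = A := by simp [cone]
  rw [← Nat.card_congr (Equiv.ofBijective a hT.bijective), Nat.card_coe_set_eq, ← hcone]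
  exact ncard_cone_le_sum_choose hT.prefix_mem (by simpa using hm) fun h =>
    hrank (hT.hasFullTypeTree h)

end Counting

section Homogeneous

theorem exists_finset_append_singleton_prefix {α : Type*} [DecidableEq α] (η : List α) (j : α) :
    ∃ s : Finset (List α), s.card = η.count j ∧ (∀ ζ ∈ s, ζ ++ [j] <+: η) ∧
      (s : Set (List α)).Pairwise fun ζ ξ => ζ ++ [j] <+: ξ ∨ ξ ++ [j] <+: ζ := by
  induction η using List.reverseRecOn with
  | nil => exact ⟨∅, by simp⟩
  | append_singleton η b ih =>
    obtain ⟨s, hcard, hprefix, hpair⟩ := ih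
    have hprefix' : ∀ ζ ∈ s, ζ ++ [j] <+: η ++ [b] := fun ζ hζ =>
      (hprefix ζ hζ).trans (List.prefix_append _ _)
    by_cases hb : b = j
    · subst hb
      have hη : η ∉ s := fun h => by simpa using (hprefix η h).length_le
      refine ⟨insert η s, by simp [hη, hcard], by simpa using hprefix', ?_⟩
      rw [Finset.coe_insert]
      exact hpair.insert fun ζ hζ _ => ⟨.inr (hprefix ζ hζ), .inl (hprefix ζ hζ)⟩
    · exact ⟨s, by simp [hb, hcard], hprefix', hpair⟩

theorem IsTypeTree.exists_finset_pairwise_adj_iff {V : Type*} {G : SimpleGraph V}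
    {A : Set (List Bool)} {a : A → V} (hT : IsTypeTree G A a) {η : List Bool} (hη : η ∈ A)
    (j : Bool) :
    ∃ s : Finset V, s.card = η.count j + 1 ∧
      (s : Set V).Pairwise fun x y => G.Adj x y ↔ j = true := by
  -- Extending `η` by `j` makes the top node count among those followed by `j`.
  obtain ⟨s, hcard, hprefix, hpair⟩ := exists_finset_append_singleton_prefix (η ++ [j]) j
  have hmem : ∀ ζ ∈ s, ζ ∈ A := fun ζ hζ => by
    have hlen : ζ.length ≤ η.length := by simpa using (hprefix ζ hζ).length_le
    exact hT.prefix_mem η hη ζ (List.prefix_of_prefix_length_le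
      ((List.prefix_append _ _).trans (hprefix ζ hζ)) (List.prefix_append _ _) hlen)
  lift s to Finset A using hmem
  refine ⟨s.map ⟨a, hT.bijective.1⟩, ?_, ?_⟩
  · rw [Finset.card_map, ← Finset.card_image_of_injective s Subtype.coe_injective, hcard]
    simp
  · rw [Finset.coe_map]
    refine Set.Pairwise.image fun ζ hζ ξ hξ hne => ?_
    rcases hpair (Finset.mem_image_of_mem _ hζ) (Finset.mem_image_of_mem _ hξ)
      (Subtype.coe_injective.ne hne) with hζξ | hξζ
    · exact hT.adj_iff hζξ
    · exact (G.adj_comm _ _).trans (hT.adj_iff hξζ)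

theorem IsTypeTree.exists_isClique_or_isIndepSet {V : Type*} {G : SimpleGraph V}
    {A : Set (List Bool)} {a : A → V} (hT : IsTypeTree G A a) {η : List Bool} (hη : η ∈ A) :
    ∃ s : Finset V, (G.IsClique (s : Set V) ∨ G.IsIndepSet (s : Set V)) ∧
      η.length + 2 ≤ 2 * s.card := by
  obtain ⟨s, hs, hclique⟩ := hT.exists_finset_pairwise_adj_iff hη true
  obtain ⟨u, hu, hindep⟩ := hT.exists_finset_pairwise_adj_iff hη false
  have hcount := List.count_true_add_count_false η
  rcases le_total s.card u.card with hle | hle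
  · exact ⟨u, .inr (hindep.imp fun x y h => by simpa using h), by omega⟩
  · exact ⟨s, .inl (hclique.imp fun x y h => by simpa using h), by omega⟩

end Homogeneous

section Estimates

theorem descFactorial_le_pred_pow (m : ℕ) {t : ℕ} (ht : 3 ≤ t) :
    m.descFactorial t ≤ (m - 1) ^ t := by
  induction t, ht using Nat.le_induction with
  | base =>
    rcases m with _ | _ | m
    · simp
    · simp
    · calc (m + 2).descFactorial 3 = (m + 2) * m * (m + 1) := by
            rw [Nat.succ_descFactorial_succ, Nat.succ_descFactorial_succ, Nat.descFactorial_one]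
            ring
        _ ≤ (m + 1) ^ 2 * (m + 1) := by gcongr; nlinarith
        _ = (m + 2 - 1) ^ 3 := by rw [Nat.add_sub_assoc one_le_two]; ring
  | succ t ht ih =>
    rw [Nat.descFactorial_succ, pow_succ']
    gcongr
    omega

theorem two_mul_sum_choose_two (m : ℕ) :
    2 * ∑ i ∈ Finset.range 2, m.choose (i + 1) = m * (m + 1) := by
  have hchoose : m.descFactorial 2 = 2 * m.choose 2 :=
    Nat.descFactorial_eq_factorial_mul_choose m 2
  rw [Finset.sum_range_succ, Finset.sum_range_one, zero_add, Nat.choose_one_right, mul_add,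
    one_add_one_eq_two, ← hchoose]
  rcases m with _ | m
  · rfl
  · rw [Nat.succ_descFactorial_succ, Nat.descFactorial_one]
    ring

theorem sum_choose_three_le_pred_pow {m : ℕ} (hm : 3 ≤ m) :
    ∑ i ∈ Finset.range 3, m.choose (i + 1) ≤ (m - 1) ^ 3 := by
  obtain ⟨k, rfl⟩ := Nat.exists_eq_add_of_le' hm
  have htwo := two_mul_sum_choose_two (k + 3)
  have hthree : 6 * (k + 3).choose 3 = (k + 3) * (k + 2) * (k + 1) := by
    rw [← show Nat.factorial 3 = 6 from rfl, ← Nat.descFactorial_eq_factorial_mul_choose,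
      Nat.succ_descFactorial_succ, Nat.succ_descFactorial_succ, Nat.descFactorial_one]
    ring
  rw [Finset.sum_range_succ, Nat.add_sub_assoc (by norm_num)]
  nlinarith

theorem sum_choose_mul_factorial_le_pred_pow {m t : ℕ} (ht : 3 ≤ t) (htm : t ≤ m) :
    (∑ i ∈ Finset.range t, m.choose (i + 1)) * (t - 2).factorial ≤ (m - 1) ^ t := by
  induction t, ht using Nat.le_induction with
  | base =>
    simpa using sum_choose_three_le_pred_pow htm
  | succ t ht ih =>
    have hfact : (t + 1 - 2).factorial = (t - 1) * (t - 2).factorial := by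
      obtain ⟨k, rfl⟩ := Nat.exists_eq_add_of_le' ht
      rfl
    have hchoose : m.choose (t + 1) * (t + 1 - 2).factorial ≤ (m - t) * (m - 1) ^ t := calc
      _ ≤ m.choose (t + 1) * (t + 1).factorial := by gcongr; omega
      _ = (m - t) * m.descFactorial t := by
        rw [← Nat.descFactorial_succ, Nat.descFactorial_eq_factorial_mul_choose, mul_comm]
      _ ≤ (m - t) * (m - 1) ^ t := by gcongr; exact descFactorial_le_pred_pow m ht
    calc (∑ i ∈ Finset.range (t + 1), m.choose (i + 1)) * (t + 1 - 2).factorial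
        = (t - 1) * ((∑ i ∈ Finset.range t, m.choose (i + 1)) * (t - 2).factorial) +
            m.choose (t + 1) * (t + 1 - 2).factorial := by
          rw [Finset.sum_range_succ, add_mul, hfact]; ring
      _ ≤ (t - 1) * (m - 1) ^ t + (m - t) * (m - 1) ^ t := by
          gcongr; exact ih (by omega)
      _ = (m - 1) ^ (t + 1) := by
          rw [← add_mul, pow_succ']; congr 1; omega

theorem sum_choose_mul_factorial_le_pow {m t : ℕ} (ht : 2 ≤ t) (htm : t ≤ m) :
    (∑ i ∈ Finset.range t, m.choose (i + 1)) * (t - 2).factorial ≤ m ^ t := by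
  rcases ht.eq_or_lt with rfl | ht
  · rw [Nat.sub_self, Nat.factorial_zero, mul_one]
    nlinarith [two_mul_sum_choose_two m]
  · exact (sum_choose_mul_factorial_le_pred_pow ht htm).trans (by gcongr; omega)

theorem mul_factorial_le_pred_pow {n m t : ℕ} (ht : 2 ≤ t) (htm : t ≤ m) (hm : t = 2 → 4 ≤ m)
    (hexc : ¬ (t = 2 ∧ m = 4 ∧ n = 10)) (hn : n ≤ ∑ i ∈ Finset.range t, m.choose (i + 1)) :
    n * (t - 2).factorial ≤ (m - 1) ^ t := by
  rcases ht.eq_or_lt with rfl | ht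
  · have htwo := two_mul_sum_choose_two m
    rw [Nat.sub_self, Nat.factorial_zero, mul_one]
    rcases (hm rfl).eq_or_lt with rfl | hm
    · omega
    · obtain ⟨k, rfl⟩ := Nat.exists_eq_add_of_le' (show 5 ≤ m from hm)
      rw [Nat.add_sub_assoc (by norm_num)]
      nlinarith
  · exact (Nat.mul_le_mul_right _ hn).trans (sum_choose_mul_factorial_le_pred_pow ht htm)

theorem rpow_one_div_natCast_le {x y : ℝ} {t : ℕ} (ht : t ≠ 0) (hx : 0 ≤ x) (hy : 0 ≤ y)
    (hxy : x ≤ y ^ t) : x ^ (1 / (t : ℝ)) ≤ y := by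
  rwa [one_div, Real.rpow_inv_le_iff_of_pos hx hy (by positivity), Real.rpow_natCast]

end Estimates

end TypeTree

theorem mainTheorem6_general {V : Type*} {G : SimpleGraph V} {t h : ℕ} (ht : 2 ≤ t)
    (hrank : ¬ TypeTree.HasFullTypeTree G (t + 1)) {A : Set (List Bool)} {a : A → V}
    (htree : TypeTree.IsTypeTree G A a) (hheight : TypeTree.HasHeight A h) (hth : t ≤ h) :
    ((t = 2 → 4 ≤ h) → ¬ (t = 2 ∧ h = 4 ∧ Nat.card V = 10) →
      (h : ℝ) ≥ ((Nat.card V : ℝ) * (Nat.factorial (t - 2) : ℝ)) ^ (1 / (t : ℝ)) + 1) ∧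
    (∃ s : Finset V, (G.IsClique (s : Set V) ∨ G.IsIndepSet (s : Set V)) ∧
      (s.card : ℝ) ≥
        (((Nat.card V : ℝ) * (Nat.factorial (t - 2) : ℝ)) ^ (1 / (t : ℝ)) + 1) / 2) := by
  have hcard := htree.card_le_sum_choose hheight.1 hrank
  have hroot : ∀ m : ℕ, Nat.card V * (t - 2).factorial ≤ m ^ t →
      ((Nat.card V : ℝ) * (Nat.factorial (t - 2) : ℝ)) ^ (1 / (t : ℝ)) ≤ m := fun m hm =>
    TypeTree.rpow_one_div_natCast_le (by omega) (by positivity) (by positivity)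
      (by exact_mod_cast hm)
  refine ⟨fun hfour hexc => ?_, ?_⟩
  · have hroot_pred := hroot (h - 1) (TypeTree.mul_factorial_le_pred_pow ht hth hfour hexc hcard)
    rw [Nat.cast_pred (by omega)] at hroot_pred
    linarith
  · obtain ⟨η, hη, hlen⟩ := Set.not_subset.1 hheight.2
    obtain ⟨s, hs, hlen_card⟩ := htree.exists_isClique_or_isIndepSet hη
    have hh_card : h + 1 ≤ 2 * s.card := by
      have : h - 1 ≤ η.length := not_lt.1 hlen
      omega
    have hroot_h := hroot h
      ((Nat.mul_le_mul_right _ hcard).trans (TypeTree.sum_choose_mul_factorial_le_pow ht hth))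
    have : (h : ℝ) + 1 ≤ 2 * s.card := by exact_mod_cast hh_card
    exact ⟨s, hs, by linarith⟩

theorem mainTheorem6 {V : Type*} [Finite V] (G : SimpleGraph V) (n t h : ℕ)
    (hn : Nat.card V = n) (ht : 2 ≤ t) (hrank : TypeTree.HasTreeRank G t)
    (A : Set (List Bool)) (a : A → V) (htree : TypeTree.IsTypeTree G A a)
    (hheight : TypeTree.HasHeight A h) (hh : 2 * t ≤ h) :
    (¬ (t = 2 ∧ h = 4 ∧ n = 10) →
      (h : ℝ) ≥ ((n : ℝ) * (Nat.factorial (t - 2) : ℝ)) ^ (1 / (t : ℝ)) + 1) ∧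
    (∃ s : Finset V, (G.IsClique (s : Set V) ∨ G.IsIndepSet (s : Set V)) ∧
      (s.card : ℝ) ≥
        (((n : ℝ) * (Nat.factorial (t - 2) : ℝ)) ^ (1 / (t : ℝ)) + 1) / 2) := by
  subst hn
  have h := mainTheorem6_general ht (fun hfull => (hrank.2 hfull).not_gt t.lt_succ_self) htree
    hheight (by omega)
  exact ⟨h.1 (by omega), h.2⟩
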